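/- Let $m\ge 1$, let $F=\mathbb{F}_{2^m}$ be the finite field with $2^m$ elements, and for $a\in F$ let $$K(a)=\sum_{x\in F\setminus\{0\}}(-1)^{\mathrm{Tr}(ax+1/x)}$$ be the Kloosterman sum, where $\mathrm{Tr}$ is the trace function of $F$ over $\mathbb{F}_2$. Let $b\in F$ be such that $b^8+b^4+1\neq 0$. Then $$K\left(\frac{(b^3+b^2)(b^3+b+1)^3}{b^8+b^4+1}\right)=K\left(\frac{(b^3+b^2)^3(b^3+b+1)}{b^8+b^4+1}\right).$$ -/

import Mathlib

open Classical in
/-- The binary Kloosterman sum `K(a) = ∑_{x ∈ F, x ≠ 0} (-1)^{Tr(a x + 1/x)}` over a finite field `F`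
of characteristic two, where `Tr` is the trace of `F` over the field with two elements. The exponent
is the representative `0` or `1` of the trace. -/
noncomputable def kloostermanSum {F : Type*} [Field F] [Fintype F] [Algebra (ZMod 2) F] (a : F) : ℤ :=
  ∑ x ∈ Finset.univ.filter (fun x : F => x ≠ 0),
    (-1 : ℤ) ^ (Algebra.trace (ZMod 2) F (a * x + 1 / x)).val

section BinaryTrace

variable {F : Type*} [Field F] [Fintype F] [Algebra (ZMod 2) F]

/-! With c = (b³+b²)/(b²+b+1), the claim is K(c³(c+1)) = K(c(c+1)³). Up to sign and shift, K(a)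
counts the x ≠ 0 at which `x + a / x` has a given trace, i.e. x-coordinates on y² + xy = x³ + ax or
its twist. The map x ↦ x(x+c²+c)²/(x+c²)² is the x-coordinate of a 3-isogeny with kernel at x = c²,
where `x + a / x` equals c. At trace Tr(c) + 1 the kernel is not rational, so the map is injective
(`isogeny_fiber`). It is onto by the cubic criterion `exists_root_depressed_cubic`. -/

theorem charP_two_of_algebra_zmod (F : Type*) [Field F] [Algebra (ZMod 2) F] : CharP F 2 :=
  charP_of_injective_algebraMap (algebraMap (ZMod 2) F).injective 2

theorem trace_sq (x : F) :
    Algebra.trace (ZMod 2) F (x ^ 2) = Algebra.trace (ZMod 2) F x := by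
  have := charP_two_of_algebra_zmod F
  have : ExpChar F 2 := ExpChar.prime Nat.prime_two
  have h := Algebra.trace_eq_of_algEquiv (FiniteField.frobeniusAlgEquiv (ZMod 2) F 2) x
  simpa using h

theorem trace_eq_of_add_eq {x y s : F} (h : x + y = s ^ 2 + s) :
    Algebra.trace (ZMod 2) F x = Algebra.trace (ZMod 2) F y := by
  have h' := congrArg (Algebra.trace (ZMod 2) F) h
  rw [map_add, map_add, trace_sq] at h'
  exact CharTwo.add_eq_zero.mp (h'.trans (CharTwo.add_self_eq_zero _))

theorem trace_eq_zero_of_eq {x s : F} (h : x = s ^ 2 + s) :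
    Algebra.trace (ZMod 2) F x = 0 := by
  simpa using trace_eq_of_add_eq (y := 0) (s := s) (by simpa using h)

theorem resolvent_add_eq {F : Type*} [Field F] [CharP F 2] {p r : F} (hr : r ≠ 0)
    (h : r ^ 2 + p ≠ 0) :
    1 + p / (r * (r ^ 2 + p) / p) ^ 2 + (1 + p / r ^ 2) =
      (p / (r ^ 2 + p)) ^ 2 + p / (r ^ 2 + p) := by
  field_simp
  grind

theorem isogeny_add_eq {F : Type*} [Field F] [CharP F 2] {c x : F} (h0 : x ≠ 0)
    (h1 : x + c ^ 2 ≠ 0) (h2 : x + c ^ 2 + c ≠ 0) :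
    x * (x + c ^ 2 + c) ^ 2 / (x + c ^ 2) ^ 2 +
        c * (c + 1) ^ 3 / (x * (x + c ^ 2 + c) ^ 2 / (x + c ^ 2) ^ 2) +
        (x + c ^ 3 * (c + 1) / x) =
      (c ^ 2 / (x + c ^ 2) + (c ^ 2 + c) / (x + c ^ 2 + c)) ^ 2 +
        (c ^ 2 / (x + c ^ 2) + (c ^ 2 + c) / (x + c ^ 2 + c)) := by
  field_simp
  grind

/-- Cancelling x - y leaves a quadratic in y; scaling puts it in Artin–Schreier form, so a second
point in the fiber forces a trace to vanish. -/
theorem isogeny_fiber {F : Type*} [Field F] [CharP F 2] {c x y : F} (hx : x ≠ 0)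
    (hc : c ≠ 0) (h1 : x + c ^ 2 ≠ 0) (h2 : y + c ^ 2 ≠ 0) (hne : x ≠ y)
    (h : x * (x + c ^ 2 + c) ^ 2 / (x + c ^ 2) ^ 2 =
      y * (y + c ^ 2 + c) ^ 2 / (y + c ^ 2) ^ 2) :
    (x + c ^ 3 * (c + 1) / x + c) ^ 2 =
      (y * (x + c ^ 2) ^ 2 / (c ^ 2 * x)) ^ 2 + y * (x + c ^ 2) ^ 2 / (c ^ 2 * x) := by
  rw [div_eq_div_iff (pow_ne_zero 2 h1) (pow_ne_zero 2 h2)] at h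
  have h3 : y ^ 2 * (x + c ^ 2) ^ 2 + c ^ 2 * x * y + c ^ 4 * (x + c ^ 2 + c) ^ 2 = 0 := by
    have : (x - y) * (y ^ 2 * (x + c ^ 2) ^ 2 + c ^ 2 * x * y +
        c ^ 4 * (x + c ^ 2 + c) ^ 2) = 0 := by
      simp only [CharTwo.add_sq, CharTwo.sub_eq_add] at h ⊢
      linear_combination h + y * (y ^ 2 + (c ^ 2) ^ 2 + c ^ 2) * (x ^ 2 + (c ^ 2) ^ 2) *
        CharTwo.two_eq_zero (R := F)
    exact (mul_eq_zero.mp this).resolve_left (sub_ne_zero.mpr hne)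
  have h4 : x + c ^ 3 * (c + 1) / x + c = (x + c ^ 2) * (x + c ^ 2 + c) / x := by
    field_simp
    linear_combination -(c ^ 2 * x) * CharTwo.two_eq_zero (R := F)
  rw [h4]
  field_simp
  linear_combination h3 - y * (y * (x + c ^ 2) ^ 2 + c ^ 2 * x) * CharTwo.two_eq_zero (R := F)

theorem fiber_resolvent_add_eq {F : Type*} [Field F] [CharP F 2] {c z : F} (hz : z ≠ 0)
    (hc : c ≠ 0) :
    1 + (z + c ^ 2 + c) ^ 3 / (z * c ^ 2) + (z + c * (c + 1) ^ 3 / z + c) =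
      (z / c + c) ^ 2 + (z / c + c) := by
  field_simp
  grind

/-- A cubic `t ^ 3 + p t + q` over a finite field of characteristic two whose resolvent has
trace one has a root. -/
theorem exists_root_depressed_cubic {p q : F} (hq : q ≠ 0)
    (h : Algebra.trace (ZMod 2) F (1 + p ^ 3 / q ^ 2) = 1) : ∃ t : F, t ^ 3 + p * t = q := by
  classical
  have := charP_two_of_algebra_zmod F
  have key : ∀ r s : F, r ≠ 0 → Algebra.trace (ZMod 2) F (1 + p / r ^ 2) = 1 →
      r ^ 3 + p * r = s ^ 3 + p * s → r = s := by
    intro r s hr h1 h2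
    by_contra hne
    have h3 : r ^ 2 + r * s + s ^ 2 + p = 0 := by
      have : (r - s) * (r ^ 2 + r * s + s ^ 2 + p) = 0 := by linear_combination h2
      exact (mul_eq_zero.mp this).resolve_left (sub_ne_zero.mpr hne)
    -- The quadratic divided by r² reads 1 + p/r² = (s/r)² + s/r.
    rw [trace_eq_zero_of_eq (s := s / r) (by grind)] at h1
    exact zero_ne_one h1
  by_cases hp : p = 0
  · subst hp
    have inj : Function.Injective fun r : F => r ^ 3 + 0 * r := by
      intro r s hrs
      by_cases hr : r = 0
      · subst hr
        simp only [zero_mul, add_zero] at hrs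
        exact ((pow_eq_zero_iff (by norm_num)).mp (hrs.symm.trans (by norm_num))).symm
      · exact key r s hr (by simpa using h) hrs
    exact (Finite.injective_iff_surjective.mp inj) q
  · let A := {r : F // r ≠ 0 ∧ Algebra.trace (ZMod 2) F (1 + p / r ^ 2) = 1}
    have ne : ∀ r : A, r.1 ^ 2 + p ≠ 0 := by
      rintro ⟨r, hr, h1⟩ h0
      rw [show 1 + p / r ^ 2 = (0 : F) by grind, map_zero] at h1
      exact zero_ne_one h1
    let f : A → A := fun r => ⟨(r.1 ^ 3 + p * r.1) / p, by
      have hf : (r.1 ^ 3 + p * r.1) / p = r.1 * (r.1 ^ 2 + p) / p := by ring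
      rw [hf]
      refine ⟨div_ne_zero (mul_ne_zero r.2.1 (ne r)) hp, Eq.trans ?_ r.2.2⟩
      exact trace_eq_of_add_eq (resolvent_add_eq r.2.1 (ne r))⟩
    have inj : Function.Injective f := by
      intro r s hrs
      have h2 : (r.1 ^ 3 + p * r.1) / p = (s.1 ^ 3 + p * s.1) / p := congrArg Subtype.val hrs
      exact Subtype.ext (key r.1 s.1 r.2.1 r.2.2 ((div_left_inj' hp).mp h2))
    obtain ⟨r, hr⟩ := Finite.injective_iff_surjective.mp inj
      ⟨q / p, div_ne_zero hq hp, by rw [← h]; congr 2; field_simp⟩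
    have h2 : (r.1 ^ 3 + p * r.1) / p = q / p := congrArg Subtype.val hr
    exact ⟨r.1, (div_left_inj' hp).mp h2⟩

open Classical in
/-- The nonzero `x` at which `x + a / x` has trace `t`. -/
noncomputable def kloostermanLevel (a : F) (t : ZMod 2) : Finset F :=
  Finset.univ.filter fun x => x ≠ 0 ∧ Algebra.trace (ZMod 2) F (x + a / x) = t

theorem mem_kloostermanLevel {a x : F} {t : ZMod 2} :
    x ∈ kloostermanLevel a t ↔ x ≠ 0 ∧ Algebra.trace (ZMod 2) F (x + a / x) = t := by
  simp [kloostermanLevel]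

open Classical in
theorem kloostermanSum_eq_card_level (a : F) (t : ZMod 2) :
    kloostermanSum a = (-1) ^ t.val *
      (2 * (kloostermanLevel a t).card -
        ((Finset.univ.filter fun x : F => x ≠ 0).card : ℤ)) := by
  have h1 : kloostermanSum a = ∑ x ∈ Finset.univ.filter (fun x : F => x ≠ 0),
      (-1 : ℤ) ^ (Algebra.trace (ZMod 2) F (x + a / x)).val := by
    refine Finset.sum_nbij' (fun x => x⁻¹) (fun x => x⁻¹) ?_ ?_ ?_ ?_ ?_
    · simp
    · simp
    · simp
    · simp
    · intro x _
      congr 3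
      rw [div_inv_eq_mul, one_div, add_comm]
  have h2 : ∀ u : ZMod 2, (-1 : ℤ) ^ u.val = (-1) ^ t.val * (2 * (if u = t then 1 else 0) - 1) := by
    revert t; decide
  rw [h1, Finset.sum_congr rfl fun x _ => h2 _, ← Finset.mul_sum, Finset.sum_sub_distrib,
    ← Finset.mul_sum, Finset.sum_boole, Finset.filter_filter]
  simp [kloostermanLevel]

/-- The `x`-coordinate of a 3-isogeny is a bijection between the level sets on which the kernel
is not rational. -/
theorem card_kloostermanLevel_eq (c : F) (hc : c ≠ 0) :
    (kloostermanLevel (c ^ 3 * (c + 1)) (Algebra.trace (ZMod 2) F c + 1)).card =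
      (kloostermanLevel (c * (c + 1) ^ 3) (Algebra.trace (ZMod 2) F c + 1)).card := by
  have := charP_two_of_algebra_zmod F
  set τ := Algebra.trace (ZMod 2) F c with hτ
  have hτ1 : τ + 1 ≠ τ := by simp
  have hpole : ∀ x ∈ kloostermanLevel (c ^ 3 * (c + 1)) (τ + 1), x + c ^ 2 ≠ 0 := by
    intro x hx h0
    obtain ⟨hx0, hx⟩ := mem_kloostermanLevel.mp hx
    have hxc : x = c ^ 2 := by grind
    subst hxc
    have : c ^ 2 + c ^ 3 * (c + 1) / c ^ 2 = c := by grind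
    rw [this] at hx
    exact hτ1 hx.symm
  -- c² + c is the image of c² under x ↦ a/x, so the trace there is again Tr(c).
  have hzero : ∀ x ∈ kloostermanLevel (c ^ 3 * (c + 1)) (τ + 1), x + c ^ 2 + c ≠ 0 := by
    intro x hx h0
    obtain ⟨hx0, hx⟩ := mem_kloostermanLevel.mp hx
    have hxc : x = c ^ 2 + c := by grind
    have : x + c ^ 3 * (c + 1) / x = c := by grind
    rw [this] at hx
    exact hτ1 hx.symm
  have htrace : ∀ x : F, x ≠ 0 → x + c ^ 2 ≠ 0 → x + c ^ 2 + c ≠ 0 →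
      Algebra.trace (ZMod 2) F (x * (x + c ^ 2 + c) ^ 2 / (x + c ^ 2) ^ 2 +
        c * (c + 1) ^ 3 / (x * (x + c ^ 2 + c) ^ 2 / (x + c ^ 2) ^ 2)) =
      Algebra.trace (ZMod 2) F (x + c ^ 3 * (c + 1) / x) := by
    intro x h0 h1 h2
    exact trace_eq_of_add_eq (isogeny_add_eq h0 h1 h2)
  refine Finset.card_nbij (fun x => x * (x + c ^ 2 + c) ^ 2 / (x + c ^ 2) ^ 2) ?_ ?_ ?_
  · intro x hx
    have h1 := hpole x hx
    have h2 := hzero x hx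
    obtain ⟨h0, h⟩ := mem_kloostermanLevel.mp hx
    exact mem_kloostermanLevel.mpr
      ⟨div_ne_zero (mul_ne_zero h0 (pow_ne_zero 2 h2)) (pow_ne_zero 2 h1),
        (htrace x h0 h1 h2).trans h⟩
  · intro x hx y hy hxy
    obtain ⟨hx0, h⟩ := mem_kloostermanLevel.mp hx
    by_contra hne
    have h0 := trace_eq_zero_of_eq (isogeny_fiber hx0 hc (hpole x hx) (hpole y hy) hne hxy)
    rw [trace_sq, map_add, h, ← hτ, add_right_comm, CharTwo.add_self_eq_zero, zero_add] at h0
    exact one_ne_zero h0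
  · intro z hz
    obtain ⟨hz0, h⟩ := mem_kloostermanLevel.mp hz
    have hres : Algebra.trace (ZMod 2) F
        (1 + ((z + c ^ 2 + c) ^ 2) ^ 3 / (z * c ^ 2) ^ 2) = 1 := by
      have hsq : 1 + ((z + c ^ 2 + c) ^ 2) ^ 3 / (z * c ^ 2) ^ 2 =
          (1 + (z + c ^ 2 + c) ^ 3 / (z * c ^ 2)) ^ 2 := by
        rw [CharTwo.add_sq (1 : F), one_pow, div_pow, pow_right_comm]
      rw [hsq, trace_sq, trace_eq_of_add_eq (fiber_resolvent_add_eq hz0 hc), map_add, h, ← hτ,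
        add_right_comm, CharTwo.add_self_eq_zero, zero_add]
    obtain ⟨t, ht⟩ := exists_root_depressed_cubic (mul_ne_zero hz0 (pow_ne_zero 2 hc)) hres
    -- The shift by z removes the quadratic term of the fiber equation, leaving p = (z+c²+c)² and q
    -- = zc².
    obtain ⟨x, rfl⟩ : ∃ x, t = x + z := ⟨t - z, by ring⟩
    have hx : x * (x + c ^ 2 + c) ^ 2 = z * (x + c ^ 2) ^ 2 := by grind
    have h1 : x + c ^ 2 ≠ 0 := by grind
    have hxz : x * (x + c ^ 2 + c) ^ 2 / (x + c ^ 2) ^ 2 = z := by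
      rw [hx, mul_div_cancel_right₀ _ (pow_ne_zero 2 h1)]
    have hxne : x * (x + c ^ 2 + c) ^ 2 ≠ 0 := hx ▸ mul_ne_zero hz0 (pow_ne_zero 2 h1)
    have h0 : x ≠ 0 := left_ne_zero_of_mul hxne
    have h2 : x + c ^ 2 + c ≠ 0 := fun h => hxne (by rw [h]; ring)
    refine ⟨x, mem_kloostermanLevel.mpr ⟨h0, ?_⟩, hxz⟩
    rw [← htrace x h0 h1 h2, hxz, h]

end BinaryTrace

theorem kloostermanSum_pow_three_mul {F : Type*} [Field F] [Fintype F] [Algebra (ZMod 2) F]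
    (c : F) : kloostermanSum (c ^ 3 * (c + 1)) = kloostermanSum (c * (c + 1) ^ 3) := by
  by_cases hc : c = 0
  · simp [hc]
  · rw [kloostermanSum_eq_card_level _ (Algebra.trace (ZMod 2) F c + 1),
      kloostermanSum_eq_card_level (c * (c + 1) ^ 3) (Algebra.trace (ZMod 2) F c + 1),
      card_kloostermanLevel_eq c hc]

theorem corollary5 {F : Type*} [Field F] [Fintype F] [Algebra (ZMod 2) F] (b : F)
    (hb : b ^ 8 + b ^ 4 + 1 ≠ 0) :
    kloostermanSum ((b ^ 3 + b ^ 2) * (b ^ 3 + b + 1) ^ 3 / (b ^ 8 + b ^ 4 + 1)) =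
      kloostermanSum ((b ^ 3 + b ^ 2) ^ 3 * (b ^ 3 + b + 1) / (b ^ 8 + b ^ 4 + 1)) := by
  have := charP_two_of_algebra_zmod F
  have hd : b ^ 8 + b ^ 4 + 1 = (b ^ 2 + b + 1) ^ 4 := by grind
  have hd0 : b ^ 2 + b + 1 ≠ 0 := fun h => hb (by rw [hd, h]; norm_num)
  have hc : (b ^ 3 + b ^ 2) / (b ^ 2 + b + 1) + 1 = (b ^ 3 + b + 1) / (b ^ 2 + b + 1) := by grind
  have h := kloostermanSum_pow_three_mul ((b ^ 3 + b ^ 2) / (b ^ 2 + b + 1))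
  rw [hc] at h
  rw [hd]
  convert h.symm using 2 <;> field_simp
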